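/- **Conventions.** A state is a positive semidefinite operator of trace $1$. A pure stabilizer state on $N$ qubits is a unit vector fixed by exactly $2^N$ elements of the $N$-qubit Pauli group (tensor products of $1,X,Y,Z$ with phases $\pm1,\pm i$). The free states $\mathcal F$ on $N$ qubits are the convex combinations of the projectors $|\psi\rangle\langle\psi|$ onto pure stabilizer states. A free sub-operation is a completely positive, trace-nonincreasing linear map $\mathcal L$ such that for every $\omega\in\mathcal F$ there are $t\ge 0$ and $\sigma\in\mathcal F$ with $\mathcal L(\omega)=t\,\sigma$. A free probabilistic protocol is a channel (completely positive trace-preserving map) of the form $\mathcal E(X)=|0\rangle\langle 0|\otimes\mathcal L(X)+|1\rangle\langle 1|\otimes\mathcal G(X)$, where the first factor is a flag bit and $\mathcal L$ is a free sub-operation (the successful branch). On input $\rho$ it succeeds with probability $p$ and outputs the state $\tau$ if $\mathcal L(\rho)=p\,\tau$. For a state $\hat\rho$ let $\lambda_{\min}(\hat\rho)$ be its smallest eigenvalue and let $R(\hat\rho)=\inf\{s\ge 0 : \exists \text{ a state } \sigma,\ (\hat\rho+s\sigma)/(1+s)\in\mathcal F\}$ be its generalized robustness. Let $|T\rangle=(|0\rangle+e^{i\pi/4}|1\rangle)/\sqrt2$.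 **Theorem.** Let $\hat\rho$ be a full-rank state on $k\ge 1$ qubits, let $n\ge 0$ and $m\ge 1$ be integers, and let $\epsilon>0$. Suppose that a free probabilistic protocol with input $\hat\rho^{\otimes n}$ succeeds with probability $p>0$ and then outputs an $m$-qubit state $\tau$ such that $\langle T|\tau_i|T\rangle\ge 1-\epsilon$ for every $i=1,\dots,m$, where $\tau_i$ is the reduced state of the $i$-th qubit of $\tau$. Then the average overhead $C:=n/m$ satisfies $$\frac nm\;\ge\;\frac1m\,\log_{\frac{1+R(\hat\rho)}{\lambda_{\min}(\hat\rho)}}\frac{\big((4-2\sqrt2)^m-1\big)\,p}{(4-2\sqrt2)^m\,m\,\epsilon}.$$ -/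

import Mathlib

open scoped ComplexOrder

namespace MagicDistillation

noncomputable section

/-- Computational basis labels of a register of qubits indexed by `ι`. -/
abbrev Bits (ι : Type*) := ι → Fin 2

/-- Operators on a finite-dimensional Hilbert space with orthonormal basis `a`. -/
abbrev Op (a : Type*) := Matrix a a ℂ

/-- Density operators. -/
def IsState {a : Type*} [Fintype a] (ρ : Op a) : Prop :=
  ρ.PosSemidef ∧ ρ.trace = 1

/-- The rank-one operator `|ψ⟩⟨ψ|`. -/
def ketBra {a : Type*} (ψ : a → ℂ) : Op a :=
  Matrix.vecMulVec ψ (star ψ)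

/-- `⟨ψ| ρ |ψ⟩`, the overlap (fidelity) of `ρ` with the pure state `ψ`. -/
def overlap {a : Type*} [Fintype a] (ψ : a → ℂ) (ρ : Op a) : ℝ :=
  (star ψ ⬝ᵥ (ρ.mulVec ψ)).re

/-- The smallest eigenvalue of a Hermitian operator. -/
def minEigenvalue {a : Type*} [Fintype a] [DecidableEq a] (ρ : Op a) : ℝ :=
  sInf (spectrum ℝ ρ)

/-! ### Stabilizer states -/

/-- The single-qubit Pauli matrices `1, X, Y, Z`. -/
def pauli : Fin 4 → Op (Fin 2) :=
  ![1, !![0, 1; 1, 0], !![0, -Complex.I; Complex.I, 0], !![1, 0; 0, -1]]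

/-- The Pauli string `⨂ i, σ_{v i}`. -/
def pauliString {ι : Type*} [Fintype ι] (v : ι → Fin 4) : Op (Bits ι) :=
  Matrix.of fun x y => ∏ i, pauli (v i) (x i) (y i)

/-- The Pauli group: Pauli strings with a phase in `{1, i, -1, -i}`. -/
def pauliGroup (ι : Type*) [Fintype ι] : Set (Op (Bits ι)) :=
  {g | ∃ c : ℂ, c ^ 4 = 1 ∧ ∃ v : ι → Fin 4, g = c • pauliString v}

/-- Pure stabilizer states: unit vectors fixed by exactly `2 ^ (number of qubits)` elements of
the Pauli group. -/
def IsStabilizerVector {ι : Type*} [Fintype ι] [DecidableEq ι] (ψ : Bits ι → ℂ) : Prop :=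
  star ψ ⬝ᵥ ψ = 1 ∧
    {g ∈ pauliGroup ι | g.mulVec ψ = ψ}.ncard = 2 ^ Fintype.card ι

/-- The free states of the resource theory of magic: convex mixtures of pure stabilizer
states. -/
def freeStates (ι : Type*) [Fintype ι] [DecidableEq ι] : Set (Op (Bits ι)) :=
  convexHull ℝ {ρ | ∃ ψ : Bits ι → ℂ, IsStabilizerVector ψ ∧ ρ = ketBra ψ}

/-- The generalized robustness: the least `s ≥ 0` such that `(ρ + s σ) / (1 + s)` is free for
some state `σ`. -/
def robustness {ι : Type*} [Fintype ι] [DecidableEq ι] (ρ : Op (Bits ι)) : ℝ :=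
  sInf {s : ℝ | 0 ≤ s ∧ ∃ σ : Op (Bits ι), IsState σ ∧
    (1 + s)⁻¹ • (ρ + s • σ) ∈ freeStates ι}

/-! ### Quantum operations -/

/-- The map `id_r ⊗ L`. -/
def amplify {a b : Type*} (r : ℕ) (L : Op a →ₗ[ℂ] Op b) (X : Op (Fin r × a)) :
    Op (Fin r × b) :=
  Matrix.of fun s t => L (Matrix.of fun x y => X (s.1, x) (t.1, y)) s.2 t.2

/-- Complete positivity. -/
def IsCP {a b : Type*} [Fintype a] [Fintype b] (L : Op a →ₗ[ℂ] Op b) : Prop :=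
  ∀ (r : ℕ) (X : Op (Fin r × a)), X.PosSemidef → (amplify r L X).PosSemidef

/-- Quantum channels: completely positive trace-preserving maps. -/
def IsChannel {a b : Type*} [Fintype a] [Fintype b] (L : Op a →ₗ[ℂ] Op b) : Prop :=
  IsCP L ∧ ∀ X, (L X).trace = X.trace

/-- Sub-operations: completely positive trace-nonincreasing maps. -/
def IsSubOperation {a b : Type*} [Fintype a] [Fintype b] (L : Op a →ₗ[ℂ] Op b) : Prop :=
  IsCP L ∧ ∀ X : Op a, X.PosSemidef → (L X).trace.re ≤ X.trace.re

/-- Free sub-operations (the largest class obeying the golden rule): sub-operations that send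
every free state to a nonnegative multiple of a free state. -/
def IsFreeSubOperation {ι κ : Type*} [Fintype ι] [DecidableEq ι] [Fintype κ] [DecidableEq κ]
    (L : Op (Bits ι) →ₗ[ℂ] Op (Bits κ)) : Prop :=
  IsSubOperation L ∧
    ∀ ω ∈ freeStates ι, ∃ t : ℝ, 0 ≤ t ∧ ∃ σ ∈ freeStates κ, L ω = t • σ

/-- `E` is a free probabilistic protocol whose successful branch is `L`: a channel
`E(X) = |0⟩⟨0| ⊗ L(X) + |1⟩⟨1| ⊗ G(X)` into a flag bit and the output register, where `L` is a
free sub-operation. -/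
def IsFreeProtocol {ι κ : Type*} [Fintype ι] [DecidableEq ι] [Fintype κ] [DecidableEq κ]
    (E : Op (Bits ι) →ₗ[ℂ] Op (Fin 2 × Bits κ)) (L : Op (Bits ι) →ₗ[ℂ] Op (Bits κ)) : Prop :=
  IsChannel E ∧ IsFreeSubOperation L ∧
    ∃ G : Op (Bits ι) →ₗ[ℂ] Op (Bits κ), ∀ X,
      E X = Matrix.kronecker (Matrix.single 0 0 1) (L X)
        + Matrix.kronecker (Matrix.single 1 1 1) (G X)

/-! ### The distillation task -/

/-- `ρ^{⊗ n}`, as an operator on the register of the `n · k` qubits indexed by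
(copy, qubit of the copy). -/
def copies {ι : Type*} (n : ℕ) (ρ : Op (Bits ι)) : Op (Bits (Fin n × ι)) :=
  Matrix.of fun x y => ∏ j, ρ (fun i => x (j, i)) (fun i => y (j, i))

/-- The reduced state of qubit `i` (partial trace over all the other qubits). -/
def marginal {κ : Type*} [Fintype κ] [DecidableEq κ] (τ : Op (Bits κ)) (i : κ) : Op (Fin 2) :=
  Matrix.of fun a b => ∑ x : Bits κ with x i = a, τ x (Function.update x i b)

/-- `|T⟩ = (|0⟩ + e^{iπ/4} |1⟩) / √2`. -/
def ketT : Fin 2 → ℂ :=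
  ![1 / (√2 : ℝ), Complex.exp (Complex.I * Real.pi / 4) / (√2 : ℝ)]

end

end MagicDistillation

open MagicDistillation

namespace MagicDistillation

/-! The argument traps the input between multiples of a free state. Let `ω = (ρ + s σ) / (1 + s)` be
free and let `λ` be the least eigenvalue of `ρ`. Then `ρ ≥ λ 1 ≥ λ ω`, because a state is at most
`1`, and `ω ≥ ρ / (1 + s)` by construction. Both inequalities survive tensor powers and the
completely positive map `L`. Since `L` sends `ω^{⊗ n}` to `t σ'` with `σ'` free, they become `p τ ≥
λ^n t σ'` and `t σ' ≥ (1 + s)^{-n} p τ`. The trace of the second bounds `t` from below. The weight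
of the first outside a target vector `ψ` then gives `λ^n (1 - f) ≤ (1 + s)^n (infidelity of τ)`,
where `f` bounds the overlap of `ψ` with free states. This is `infidelity_bound`; the factor `p`
cancels in it.

For `ψ = |T⟩^{⊗ m}` two estimates remain. A union bound over the qubits,
`infidelity_tensorVec_le_sum_marginal`, makes the infidelity of `τ` at most `m ε`. For `f`, the
overlap of `ψ` with a pure stabilizer state is `2^{-m}` times a sum of products of Pauli expectation
values. That sum is supported on the stabilizer, a commuting set of Pauli strings, so the
combinatorial bound `sum_prod_pauliWeight_le` gives `f = ((1 + 1/√2) / 2)^m = (4 - 2√2)^{-m}`.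

Finally `s` is replaced by the infimum and logarithms are taken. -/

open scoped MatrixOrder in
theorem exists_eq_conjTranspose_mul_self {a : Type*} [Fintype a] {A : Op a} (hA : A.PosSemidef) :
    ∃ B : Op a, A = B.conjTranspose * B := by
  classical
  exact CStarAlgebra.nonneg_iff_eq_star_mul_self.1 hA.nonneg

/-! ### Tensor products of families of operators and vectors -/

section Tensor

variable {J a b c : Type*} [Fintype J]

/-- The tensor product of a family of matrices. -/
def tensorMatrix (A : J → Matrix a b ℂ) : Matrix (J → a) (J → b) ℂ :=
  Matrix.of fun x y => ∏ j, A j (x j) (y j)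

/-- The tensor product of a family of vectors. -/
def tensorVec (ψ : J → a → ℂ) : (J → a) → ℂ := fun x => ∏ j, ψ j (x j)

theorem sum_prod_pi [DecidableEq J] [Fintype a] (f : J → a → ℂ) :
    ∑ x : J → a, ∏ j, f j (x j) = ∏ j, ∑ i, f j i := by
  rw [Finset.prod_univ_sum, Fintype.piFinset_univ]

theorem tensorMatrix_mul [DecidableEq J] [Fintype b] (A : J → Matrix a b ℂ)
    (B : J → Matrix b c ℂ) :
    tensorMatrix A * tensorMatrix B = tensorMatrix fun j => A j * B j := by
  ext x y
  simp [tensorMatrix, Matrix.mul_apply, ← Finset.prod_mul_distrib,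
    sum_prod_pi fun j i => A j (x j) i * B j i (y j)]

theorem tensorMatrix_mulVec [DecidableEq J] [Fintype b] (A : J → Matrix a b ℂ) (ψ : J → b → ℂ) :
    (tensorMatrix A).mulVec (tensorVec ψ) = tensorVec fun j => (A j).mulVec (ψ j) := by
  ext x
  simp [tensorMatrix, tensorVec, Matrix.mulVec, dotProduct, ← Finset.prod_mul_distrib,
    sum_prod_pi fun j i => A j (x j) i * ψ j i]

theorem star_tensorVec (ψ : J → a → ℂ) :
    star (tensorVec ψ) = tensorVec fun j => star (ψ j) := by
  ext x
  simp [tensorVec]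

theorem tensorVec_dotProduct [DecidableEq J] [Fintype a] (φ ψ : J → a → ℂ) :
    tensorVec φ ⬝ᵥ tensorVec ψ = ∏ j, φ j ⬝ᵥ ψ j := by
  simp [tensorVec, dotProduct, ← Finset.prod_mul_distrib, sum_prod_pi fun j i => φ j i * ψ j i]

theorem trace_tensorMatrix [DecidableEq J] [Fintype a] (A : J → Matrix a a ℂ) :
    (tensorMatrix A).trace = ∏ j, (A j).trace := by
  simp [tensorMatrix, Matrix.trace, sum_prod_pi fun j i => A j i i]

theorem conjTranspose_tensorMatrix (A : J → Matrix a b ℂ) :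
    (tensorMatrix A).conjTranspose = tensorMatrix fun j => (A j).conjTranspose := by
  ext x y
  simp [tensorMatrix]

theorem tensorMatrix_one [DecidableEq a] : tensorMatrix (fun _ : J => (1 : Matrix a a ℂ)) = 1 := by
  ext x y
  simp only [tensorMatrix, Matrix.of_apply, Matrix.one_apply, Finset.prod_ite_zero, funext_iff]
  simp

theorem tensorMatrix_smul (r : J → ℂ) (A : J → Matrix a b ℂ) :
    (tensorMatrix fun j => r j • A j) = (∏ j, r j) • tensorMatrix A := by
  ext x y
  simp [tensorMatrix, Finset.prod_mul_distrib]

theorem tensorMatrix_sum [DecidableEq J] {I : Type*} [Fintype I] (A : J → I → Matrix a b ℂ) :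
    (tensorMatrix fun j => ∑ i, A j i) = ∑ f : J → I, tensorMatrix fun j => A j (f j) := by
  ext x y
  simp [tensorMatrix, Matrix.sum_apply, sum_prod_pi fun j i => A j i (x j) (y j)]

theorem ketBra_tensorVec (ψ : J → a → ℂ) :
    ketBra (tensorVec ψ) = tensorMatrix fun j => ketBra (ψ j) := by
  ext x y
  simp [ketBra, tensorVec, tensorMatrix, Matrix.vecMulVec_apply, Finset.prod_mul_distrib]

theorem posSemidef_tensorMatrix [DecidableEq J] [Finite a] {A : J → Matrix a a ℂ}
    (hA : ∀ j, (A j).PosSemidef) : (tensorMatrix A).PosSemidef := by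
  classical
  have := Fintype.ofFinite a
  choose B hB using fun j => exists_eq_conjTranspose_mul_self (hA j)
  have : tensorMatrix A = (tensorMatrix B).conjTranspose * tensorMatrix B := by
    rw [conjTranspose_tensorMatrix, tensorMatrix_mul]
    simp_rw [← hB]
  rw [this]
  exact Matrix.posSemidef_conjTranspose_mul_self _

/-- The tensor power is monotone for the Loewner order. -/
theorem posSemidef_tensorMatrix_sub [DecidableEq J] [Finite a] {A B : Matrix a a ℂ}
    (hB : B.PosSemidef) (hAB : (A - B).PosSemidef) :
    (tensorMatrix (fun _ : J => A) - tensorMatrix fun _ : J => B).PosSemidef := by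
  classical
  -- Expand the power of `A = B + (A - B)` over all choices of factor. The all-`B` term is what gets
  -- subtracted, and every other term is a product of positive operators.
  have h : tensorMatrix (fun _ : J => A)
      = ∑ f : J → Bool, tensorMatrix fun j => bif f j then B else A - B := by
    rw [← tensorMatrix_sum (fun (_ : J) (i : Bool) => bif i then B else A - B)]
    simp
  rw [h, ← Finset.add_sum_erase _ _ (Finset.mem_univ (fun _ : J => true))]
  simp only [cond_true, add_sub_cancel_left]
  refine Matrix.posSemidef_sum _ fun f _ => posSemidef_tensorMatrix fun j => ?_
  cases f j <;> simpa

end Tensor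

/-! ### Positive semidefinite operators -/

section Positive

variable {a b : Type*} [Fintype a] [Fintype b]

theorem PosSemidef.trace_mul_nonneg {A B : Op a} (hA : A.PosSemidef) (hB : B.PosSemidef) :
    0 ≤ (A * B).trace := by
  classical
  obtain ⟨C, rfl⟩ := exists_eq_conjTranspose_mul_self hB
  rw [← Matrix.mul_assoc, Matrix.trace_mul_comm, ← Matrix.mul_assoc]
  exact (hA.mul_mul_conjTranspose_same C).trace_nonneg

theorem trace_mul_ketBra (A : Op a) (ψ : a → ℂ) :
    (A * ketBra ψ).trace = star ψ ⬝ᵥ A.mulVec ψ := by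
  rw [ketBra, Matrix.mul_vecMulVec, Matrix.trace_vecMulVec, dotProduct_comm]

theorem posSemidef_ketBra (ψ : a → ℂ) : (ketBra ψ).PosSemidef :=
  Matrix.posSemidef_vecMulVec_self_star ψ

theorem posSemidef_one_sub_ketBra [DecidableEq a] {ψ : a → ℂ} (hψ : star ψ ⬝ᵥ ψ = 1) :
    (1 - ketBra ψ).PosSemidef := by
  have hH : (1 - ketBra ψ).conjTranspose = 1 - ketBra ψ := by
    rw [Matrix.conjTranspose_sub, Matrix.conjTranspose_one, (posSemidef_ketBra ψ).isHermitian.eq]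
  have hi : ketBra ψ * ketBra ψ = ketBra ψ := by
    simp [ketBra, Matrix.vecMulVec_mul_vecMulVec, hψ]
  have : 1 - ketBra ψ = (1 - ketBra ψ).conjTranspose * (1 - ketBra ψ) := by
    rw [hH, sub_mul, mul_sub, mul_sub, hi]
    simp
  rw [this]
  exact Matrix.posSemidef_conjTranspose_mul_self _

/-- The weight of `X` outside the direction `ψ`. -/
noncomputable def infidelity (ψ : a → ℂ) (X : Op a) : ℝ := X.trace.re - overlap ψ X

theorem infidelity_nonneg {ψ : a → ℂ} (hψ : star ψ ⬝ᵥ ψ = 1) {X : Op a} (hX : X.PosSemidef) :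
    0 ≤ infidelity ψ X := by
  classical
  have h := PosSemidef.trace_mul_nonneg hX (posSemidef_one_sub_ketBra hψ)
  rw [mul_sub, mul_one, Matrix.trace_sub, trace_mul_ketBra] at h
  have := (Complex.le_def.1 h).1
  simpa [infidelity, overlap] using this

theorem overlap_sub (ψ : a → ℂ) (X Y : Op a) : overlap ψ (X - Y) = overlap ψ X - overlap ψ Y := by
  simp [overlap, Matrix.sub_mulVec]

theorem overlap_smul (ψ : a → ℂ) (r : ℝ) (X : Op a) : overlap ψ (r • X) = r * overlap ψ X := by
  simp [overlap, Matrix.smul_mulVec]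

theorem infidelity_sub (ψ : a → ℂ) (X Y : Op a) :
    infidelity ψ (X - Y) = infidelity ψ X - infidelity ψ Y := by
  simp [infidelity, overlap_sub]
  ring

theorem infidelity_smul (ψ : a → ℂ) (r : ℝ) (X : Op a) :
    infidelity ψ (r • X) = r * infidelity ψ X := by
  simp [infidelity, overlap_smul, mul_sub]

/-- Complete positivity with an ancilla of dimension one. -/
theorem IsCP.posSemidef {L : Op a →ₗ[ℂ] Op b} (hL : IsCP L) {X : Op a} (hX : X.PosSemidef) :
    (L X).PosSemidef := by
  have h := (hL 1 (X.submatrix Prod.snd Prod.snd) (hX.submatrix _)).submatrix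
    (fun y : b => ((0 : Fin 1), y))
  exact h

/-- An affine function of a Hermitian matrix is positive if it is so on the eigenvalues. -/
theorem posSemidef_affine [DecidableEq a] {A : Op a} (hA : A.IsHermitian) {r c : ℝ}
    (hr : ∀ i, 0 ≤ r + c * hA.eigenvalues i) : (r • (1 : Op a) + c • A).PosSemidef := by
  have h : r • (1 : Op a) + c • A = Unitary.conjStarAlgAut ℂ _ hA.eigenvectorUnitary
      (Matrix.diagonal fun i => ((r + c * hA.eigenvalues i : ℝ) : ℂ)) := by
    have hd : (Matrix.diagonal fun i => ((r + c * hA.eigenvalues i : ℝ) : ℂ))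
        = (r : ℂ) • (1 : Op a)
          + (c : ℂ) • Matrix.diagonal ((RCLike.ofReal : ℝ → ℂ) ∘ hA.eigenvalues) := by
      ext i j
      by_cases hij : i = j <;> simp [hij]
    rw [hd, map_add, map_smul, map_smul, map_one, ← hA.spectral_theorem]
    ext i j
    simp
  rw [h, Unitary.conjStarAlgAut_apply]
  refine Matrix.PosSemidef.mul_mul_conjTranspose_same (Matrix.PosSemidef.diagonal fun i => ?_) _
  exact Complex.zero_le_real.2 (hr i)

/-- Each eigenvalue is at most the sum of all of them. For a state this makes `1 - A` positive,
which supplies a mixing partner in the robustness. -/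
theorem posSemidef_trace_smul_one_sub [DecidableEq a] {A : Op a} (hA : A.PosSemidef) :
    (A.trace.re • (1 : Op a) - A).PosSemidef := by
  have h : ∀ i, 0 ≤ A.trace.re + (-1) * hA.1.eigenvalues i := fun i => by
    have := Finset.single_le_sum (fun j _ => hA.eigenvalues_nonneg j) (Finset.mem_univ i)
    rw [hA.1.trace_eq_sum_eigenvalues]
    simp only [Complex.re_sum, Complex.coe_algebraMap, Complex.ofReal_re]
    linarith
  simpa [sub_eq_add_neg] using posSemidef_affine hA.1 h

theorem posSemidef_sub_minEigenvalue [DecidableEq a] {A : Op a} (hA : A.IsHermitian) :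
    (A - minEigenvalue A • (1 : Op a)).PosSemidef := by
  have h : ∀ i, 0 ≤ -minEigenvalue A + 1 * hA.eigenvalues i := fun i => by
    have : minEigenvalue A ≤ hA.eigenvalues i := by
      rw [minEigenvalue, hA.spectrum_real_eq_range_eigenvalues]
      exact csInf_le (Set.finite_range _).bddBelow ⟨i, rfl⟩
    linarith
  have := posSemidef_affine hA h
  rwa [neg_smul, one_smul, neg_add_eq_sub] at this

theorem minEigenvalue_pos [DecidableEq a] [Nonempty a] {A : Op a} (hA : A.PosSemidef)
    (hrank : A.rank = Fintype.card a) : 0 < minEigenvalue A := by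
  rw [minEigenvalue, hA.1.spectrum_real_eq_range_eigenvalues]
  obtain ⟨i, hi⟩ := (Set.range_nonempty hA.1.eigenvalues).csInf_mem (Set.finite_range _)
  rw [← hi]
  refine lt_of_le_of_ne (hA.eigenvalues_nonneg i) fun h0 => ?_
  rw [hA.1.rank_eq_card_non_zero_eigs] at hrank
  have := Fintype.card_subtype_lt (p := fun i => hA.1.eigenvalues i ≠ 0) (x := i)
    (by simp [← h0])
  omega

/-- Trace of `A - λ 1 ≥ 0`. It serves to show that the base of the final logarithm exceeds `1`. -/
theorem card_mul_minEigenvalue_le [DecidableEq a] {A : Op a} (hA : A.IsHermitian) :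
    Fintype.card a * minEigenvalue A ≤ A.trace.re := by
  have := (Complex.le_def.1 (posSemidef_sub_minEigenvalue hA).trace_nonneg).1
  simp at this
  linarith

end Positive

/-! ### Pauli strings -/

section Pauli

variable {ι : Type*} [Fintype ι]

theorem pauliString_eq_tensorMatrix (v : ι → Fin 4) :
    pauliString v = tensorMatrix fun i => pauli (v i) := rfl

theorem pauli_mul_self (p : Fin 4) : pauli p * pauli p = 1 := by
  ext i j
  fin_cases p <;> fin_cases i <;> fin_cases j <;> simp [pauli, Matrix.mul_apply]

/-- The sign with which two Pauli matrices commute. -/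
def pauliSign (p q : Fin 4) : ℤ := if p = 0 ∨ q = 0 ∨ p = q then 1 else -1

theorem pauli_mul_comm (p q : Fin 4) :
    pauli p * pauli q = (pauliSign p q : ℂ) • (pauli q * pauli p) := by
  ext i j
  fin_cases p <;> fin_cases q <;> fin_cases i <;> fin_cases j <;>
    simp [pauli, pauliSign, Matrix.mul_apply]

theorem conjTranspose_pauli (p : Fin 4) : (pauli p).conjTranspose = pauli p := by
  ext i j
  fin_cases p <;> fin_cases i <;> fin_cases j <;> simp [pauli]

theorem trace_pauli_mul (p q : Fin 4) :
    (pauli p * pauli q).trace = if p = q then 2 else 0 := by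
  fin_cases p <;> fin_cases q <;> simp [pauli, Matrix.trace] <;> norm_num

/-- Entrywise form of the fact that the sum of `σ_p ⊗ σ_p` is twice the swap of two qubits. -/
theorem sum_pauli_mul_pauli (i j k l : Fin 2) :
    ∑ p, pauli p i j * pauli p k l = if i = l ∧ j = k then 2 else 0 := by
  fin_cases i <;> fin_cases j <;> fin_cases k <;> fin_cases l <;>
    simp [pauli, Fin.sum_univ_four] <;> norm_num

theorem conjTranspose_pauliString (v : ι → Fin 4) :
    (pauliString v).conjTranspose = pauliString v := by
  simp [pauliString_eq_tensorMatrix, conjTranspose_tensorMatrix, conjTranspose_pauli]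

variable [DecidableEq ι]

theorem pauliString_mul_self (v : ι → Fin 4) : pauliString v * pauliString v = 1 := by
  simp [pauliString_eq_tensorMatrix, tensorMatrix_mul, pauli_mul_self, tensorMatrix_one]

theorem pauliString_mul_comm (v w : ι → Fin 4) :
    pauliString v * pauliString w
      = ((∏ i, pauliSign (v i) (w i) : ℤ) : ℂ) • (pauliString w * pauliString v) := by
  simp_rw [pauliString_eq_tensorMatrix, tensorMatrix_mul, pauli_mul_comm (v _) (w _)]
  rw [tensorMatrix_smul]
  simp

theorem trace_pauliString_mul (v w : ι → Fin 4) :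
    (pauliString v * pauliString w).trace = if v = w then 2 ^ Fintype.card ι else 0 := by
  simp only [pauliString_eq_tensorMatrix, tensorMatrix_mul, trace_tensorMatrix, trace_pauli_mul,
    Finset.prod_ite_zero, funext_iff]
  simp

theorem pauliString_eq_of_smul_eq {v w : ι → Fin 4} {c d : ℂ} (hc : c ≠ 0)
    (h : c • pauliString v = d • pauliString w) : v = w := by
  by_contra hvw
  have := congrArg (fun A => (A * pauliString v).trace) h
  simp [trace_pauliString_mul, Ne.symm hvw, hc] at this

theorem mulVec_ne_zero_of_mul_self {a : Type*} [Fintype a] [DecidableEq a] {A : Op a}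
    (hA : A * A = 1) {ψ : a → ℂ} (hψ : ψ ≠ 0) : A.mulVec ψ ≠ 0 := fun h => hψ <| by
  rw [← Matrix.one_mulVec ψ, ← hA, ← Matrix.mulVec_mulVec, h, Matrix.mulVec_zero]

/-! ### Stabilizer vectors -/

/-- The Pauli strings of which `ψ` is an eigenvector. -/
def stabilizerSet (ψ : Bits ι → ℂ) : Set (ι → Fin 4) :=
  {v | ∃ c : ℂ, (pauliString v).mulVec ψ = c • ψ}

theorem ne_zero_of_normalized {a : Type*} [Fintype a] {ψ : a → ℂ} (hψ : star ψ ⬝ᵥ ψ = 1) :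
    ψ ≠ 0 := by
  rintro rfl
  simp at hψ

theorem pauliString_eigenvalue_sq {ψ : Bits ι → ℂ} (hψ : ψ ≠ 0) {v : ι → Fin 4} {c : ℂ}
    (h : (pauliString v).mulVec ψ = c • ψ) : c ^ 2 = 1 := by
  have h1 : (c ^ 2) • ψ = (1 : ℂ) • ψ := by
    rw [one_smul, sq, mul_smul, ← h, ← Matrix.mulVec_smul, ← h, Matrix.mulVec_mulVec,
      pauliString_mul_self, Matrix.one_mulVec]
  exact smul_left_injective ℂ hψ h1

/-- The stabilizer group of a unit vector is in bijection with the Pauli strings having it as an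
eigenvector. -/
theorem ncard_stabilizer {ψ : Bits ι → ℂ} (hψ : star ψ ⬝ᵥ ψ = 1) :
    {g ∈ pauliGroup ι | g.mulVec ψ = ψ}.ncard = (stabilizerSet ψ).ncard := by
  have h0 := ne_zero_of_normalized hψ
  let e : (ι → Fin 4) → ℂ := fun v => star ψ ⬝ᵥ (pauliString v).mulVec ψ
  have he : ∀ v c, (pauliString v).mulVec ψ = c • ψ → e v = c := fun v c h => by
    simp [e, h, hψ]
  symm
  refine Set.ncard_congr (fun v _ => e v • pauliString v) ?_ ?_ ?_
  · rintro v ⟨c, hc⟩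
    have h2 := pauliString_eigenvalue_sq h0 hc
    rw [he v c hc]
    refine ⟨⟨c, by rw [show 4 = 2 * 2 from rfl, pow_mul, h2, one_pow], v, rfl⟩, ?_⟩
    rw [Matrix.smul_mulVec, hc, smul_smul, ← sq, h2, one_smul]
  · rintro v w ⟨c, hc⟩ _ h
    have h2 := pauliString_eigenvalue_sq h0 hc
    refine pauliString_eq_of_smul_eq (c := e v) ?_ h
    rw [he v c hc]
    rintro rfl
    simp at h2
  · rintro g ⟨⟨c, hc4, v, rfl⟩, hg⟩
    have hc0 : c ≠ 0 := by
      rintro rfl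
      simp at hc4
    have hv : (pauliString v).mulVec ψ = c⁻¹ • ψ := by
      rw [Matrix.smul_mulVec] at hg
      rw [eq_inv_smul_iff₀ hc0, hg]
    refine ⟨v, ⟨_, hv⟩, ?_⟩
    -- The eigenvalue `c⁻¹` squares to one, so the phase `c` is itself a sign and equals `c⁻¹`.
    have h2 := pauliString_eigenvalue_sq h0 hv
    simp only [he v _ hv]
    congr 1
    rw [inv_pow, inv_eq_one, sq] at h2
    exact inv_eq_of_mul_eq_one_right h2

theorem isStabilizerVector_iff {ψ : Bits ι → ℂ} :
    IsStabilizerVector ψ ↔ star ψ ⬝ᵥ ψ = 1 ∧ (stabilizerSet ψ).ncard = 2 ^ Fintype.card ι :=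
  and_congr_right fun h => by rw [ncard_stabilizer h]

end Pauli

/-! ### Products of stabilizer vectors -/

section Product

variable {J a : Type*} [Fintype J] [DecidableEq J]

/-- Freeze every coordinate except `j` at a point where the other `φ i` do not vanish, then divide
by their product. -/
theorem exists_eq_smul_of_tensorVec_eq {φ ψ : J → a → ℂ} (hφ : ∀ j, φ j ≠ 0) {c : ℂ}
    (h : tensorVec φ = c • tensorVec ψ) (j : J) : ∃ d : ℂ, φ j = d • ψ j := by
  choose y hy using fun j => Function.ne_iff.1 (hφ j)
  have hx : ∀ x : a, φ j x * ∏ i ∈ Finset.univ.erase j, φ i (y i)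
      = c * (ψ j x * ∏ i ∈ Finset.univ.erase j, ψ i (y i)) := fun x => by
    have := congrFun h (Function.update y j x)
    simp only [tensorVec, Pi.smul_apply, smul_eq_mul] at this
    rw [← Finset.mul_prod_erase _ _ (Finset.mem_univ j),
      ← Finset.mul_prod_erase _ (fun i => ψ i _) (Finset.mem_univ j)] at this
    simp only [Function.update_self] at this
    have hr : ∀ χ : J → a → ℂ, ∏ i ∈ Finset.univ.erase j, χ i (Function.update y j x i)
        = ∏ i ∈ Finset.univ.erase j, χ i (y i) := fun χ => Finset.prod_congr rfl fun i hi => by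
      rw [Function.update_of_ne (Finset.ne_of_mem_erase hi)]
    rwa [hr, hr] at this
  have hne : ∏ i ∈ Finset.univ.erase j, φ i (y i) ≠ 0 := Finset.prod_ne_zero_iff.2 fun i _ => hy i
  refine ⟨c * (∏ i ∈ Finset.univ.erase j, ψ i (y i)) / ∏ i ∈ Finset.univ.erase j, φ i (y i), ?_⟩
  ext x
  rw [Pi.smul_apply, smul_eq_mul, div_mul_eq_mul_div, eq_div_iff hne, hx]
  ring

variable [Fintype a] [DecidableEq a]

theorem eigenvector_tensorVec_iff {A : J → Op a} (hA : ∀ j, A j * A j = 1) {ψ : J → a → ℂ}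
    (hψ : ∀ j, ψ j ≠ 0) :
    (∃ c : ℂ, (tensorMatrix A).mulVec (tensorVec ψ) = c • tensorVec ψ)
      ↔ ∀ j, ∃ c : ℂ, (A j).mulVec (ψ j) = c • ψ j := by
  rw [tensorMatrix_mulVec]
  constructor
  · rintro ⟨c, hc⟩
    exact exists_eq_smul_of_tensorVec_eq (fun j => mulVec_ne_zero_of_mul_self (hA j) (hψ j)) hc
  · intro h
    choose c hc using h
    refine ⟨∏ j, c j, ?_⟩
    ext x
    simp [tensorVec, hc, Finset.prod_mul_distrib]

omit [DecidableEq J] in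
theorem ncard_pi_univ {I : Type*} (s : J → Set I) :
    {f : J → I | ∀ j, f j ∈ s j}.ncard = ∏ j, (s j).ncard := by
  simp_rw [← Nat.card_coe_set_eq]
  rw [← Nat.card_pi]
  exact Nat.card_congr (Equiv.subtypePiEquivPi)

variable {ι : Type*} [Fintype ι] [DecidableEq ι]

/-- A product of stabilizer vectors is a stabilizer vector. -/
theorem IsStabilizerVector.tensor {ψ : J → Bits ι → ℂ} (hψ : ∀ j, IsStabilizerVector (ψ j)) :
    IsStabilizerVector fun x : Bits (J × ι) => tensorVec ψ (Function.curry x) := by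
  simp_rw [isStabilizerVector_iff] at hψ ⊢
  have h0 := fun j => ne_zero_of_normalized (hψ j).1
  constructor
  · have : (star fun x : Bits (J × ι) => tensorVec ψ (Function.curry x)) ⬝ᵥ
        (fun x : Bits (J × ι) => tensorVec ψ (Function.curry x))
        = star (tensorVec ψ) ⬝ᵥ tensorVec ψ :=
      (Equiv.curry J ι (Fin 2)).sum_comp fun x => star (tensorVec ψ) x * tensorVec ψ x
    rw [this, star_tensorVec, tensorVec_dotProduct]
    simp [hψ]
  · have h : stabilizerSet (fun x : Bits (J × ι) => tensorVec ψ (Function.curry x))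
        = (Equiv.curry J ι (Fin 4)) ⁻¹' {f | ∀ j, f j ∈ stabilizerSet (ψ j)} := by
      ext v
      have hv : pauliString v = (tensorMatrix fun j => pauliString fun i => v (j, i)).submatrix
          (Equiv.curry J ι (Fin 2)) (Equiv.curry J ι (Fin 2)) := by
        ext x y
        simp [pauliString, tensorMatrix, Fintype.prod_prod_type]
      have := eigenvector_tensorVec_iff (A := fun j => pauliString fun i => v (j, i))
        (fun j => pauliString_mul_self _) h0
      refine Iff.trans ?_ this
      refine exists_congr fun c => ?_
      rw [hv, Matrix.submatrix_mulVec_equiv]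
      have hc : (fun x : Bits (J × ι) => tensorVec ψ (Function.curry x))
          ∘ (Equiv.curry J ι (Fin 2)).symm = tensorVec ψ := by
        ext x
        simp
      rw [hc]
      constructor
      · intro h
        ext x
        exact congrFun h ((Equiv.curry J ι (Fin 2)).symm x)
      · intro h
        rw [h]
        rfl
    rw [h, Set.ncard_preimage_of_injective_subset_range (Equiv.injective _)
        (by rw [Equiv.range_eq_univ]; exact Set.subset_univ _),
      ncard_pi_univ]
    simp [hψ, ← pow_mul, mul_comm]

theorem ncard_pauli_eigen_single (b : Fin 2) :
    {p : Fin 4 | ∃ c : ℂ, (pauli p).mulVec (Pi.single b 1) = c • Pi.single b 1}.ncard = 2 := by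
  have : {p : Fin 4 | ∃ c : ℂ, (pauli p).mulVec (Pi.single b 1) = c • Pi.single b 1}
      = (({0, 3} : Finset (Fin 4)) : Set (Fin 4)) := by
    ext p
    simp only [Set.mem_ofPred_eq, Matrix.mulVec_single_one, funext_iff, Fin.forall_fin_two]
    fin_cases b <;> fin_cases p <;> simp [pauli]
  rw [this, Set.ncard_coe_finset]
  rfl

/-- Computational basis vectors are stabilizer vectors. -/
theorem isStabilizerVector_single (x : Bits ι) : IsStabilizerVector (Pi.single x (1 : ℂ)) := by
  have hx : (Pi.single x (1 : ℂ) : Bits ι → ℂ) = tensorVec fun i => Pi.single (x i) 1 := by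
    ext y
    simp only [tensorVec, Pi.single_apply, Finset.prod_ite_zero, funext_iff]
    simp
  rw [isStabilizerVector_iff]
  refine ⟨by simp, ?_⟩
  have h : stabilizerSet (Pi.single x (1 : ℂ)) = {v : ι → Fin 4 | ∀ i, v i ∈
      {p : Fin 4 | ∃ c : ℂ, (pauli p).mulVec (Pi.single (x i) 1) = c • Pi.single (x i) 1}} := by
    ext v
    rw [stabilizerSet, hx]
    exact eigenvector_tensorVec_iff (fun i => pauli_mul_self _) fun i => by simp
  rw [h, ncard_pi_univ]
  simp only [ncard_pauli_eigen_single]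
  simp

/-! ### Free states -/

/-- The bound `ω ≤ 1` is what turns `ρ ≥ λ 1` into `ρ ≥ λ ω`. Both properties are convex, so
rank-one projectors suffice. -/
theorem isState_of_mem_freeStates {ω : Op (Bits ι)} (hω : ω ∈ freeStates ι) :
    IsState ω ∧ (1 - ω).PosSemidef := by
  refine convexHull_min (t := {ω | IsState ω ∧ (1 - ω).PosSemidef}) ?_ ?_ hω
  · rintro _ ⟨ψ, hψ, rfl⟩
    refine ⟨⟨posSemidef_ketBra ψ, ?_⟩, posSemidef_one_sub_ketBra hψ.1⟩
    rw [ketBra, Matrix.trace_vecMulVec, dotProduct_comm, hψ.1]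
  · rintro A ⟨⟨hA, hAt⟩, hA1⟩ B ⟨⟨hB, hBt⟩, hB1⟩ r s hr hs hrs
    refine ⟨⟨(hA.smul hr).add (hB.smul hs), ?_⟩, ?_⟩
    · simp [hAt, hBt]
      exact_mod_cast hrs
    · have : 1 - (r • A + s • B) = r • (1 - A) + s • (1 - B) := by
        rw [smul_sub, smul_sub, sub_add_sub_comm, ← add_smul, hrs, one_smul]
      rw [this]
      exact (hA1.smul hr).add (hB1.smul hs)

omit [Fintype ι] [DecidableEq ι] in
theorem copies_eq_submatrix (n : ℕ) (ρ : Op (Bits ι)) :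
    copies n ρ = (tensorMatrix fun _ : Fin n => ρ).submatrix Function.curry Function.curry := rfl

/-- Multilinear expansion writes the power of a mixture as a mixture of product stabilizer states
with product weights. -/
theorem copies_mem_freeStates (n : ℕ) {ω : Op (Bits ι)} (hω : ω ∈ freeStates ι) :
    copies n ω ∈ freeStates (Fin n × ι) := by
  obtain ⟨I, _, w, z, hw, hw1, hz, rfl⟩ := mem_convexHull_iff_exists_fintype.1 hω
  choose ψ hψ hzψ using hz
  refine mem_convexHull_of_exists_fintype (fun f : Fin n → I => ∏ j, w (f j))
    (fun f => ketBra fun x => tensorVec (fun j => ψ (f j)) (Function.curry x))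
    (fun f => Finset.prod_nonneg fun j _ => hw _) ?_
    (fun f => ⟨_, IsStabilizerVector.tensor fun j => hψ (f j), rfl⟩) ?_
  · have := Finset.prod_univ_sum (fun _ : Fin n => Finset.univ) fun (_ : Fin n) i => w i
    rw [Fintype.piFinset_univ] at this
    rw [← this]
    simp [hw1]
  · ext x y
    have := congrFun (congrFun (tensorMatrix_sum fun (_ : Fin n) i => w i • z i)
      (Function.curry x)) (Function.curry y)
    rw [copies_eq_submatrix, Matrix.submatrix_apply, this]
    simp [Matrix.sum_apply, tensorMatrix, ketBra, tensorVec, hzψ, Matrix.vecMulVec_apply,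
      Finset.prod_mul_distrib]

theorem maximallyMixed_mem_freeStates :
    ((2 : ℝ) ^ Fintype.card ι)⁻¹ • (1 : Op (Bits ι)) ∈ freeStates ι := by
  refine mem_convexHull_of_exists_fintype
    (fun _ => ((2 : ℝ) ^ Fintype.card ι)⁻¹) (fun x => ketBra (Pi.single x 1))
    (fun _ => by positivity) (by simp) (fun x => ⟨_, isStabilizerVector_single x, rfl⟩) ?_
  rw [← Finset.smul_sum]
  congr 1
  ext x y
  simp [Matrix.sum_apply, ketBra, Matrix.vecMulVec_apply, Matrix.one_apply, Pi.single_apply]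

end Product

/-! ### Pauli expectation values -/

section Expectation

variable {ι : Type*} [Fintype ι] [DecidableEq ι]

theorem sum_pauliString_mul_pauliString (x y z w : Bits ι) :
    ∑ v : ι → Fin 4, pauliString v x y * pauliString v z w
      = if x = w ∧ y = z then 2 ^ Fintype.card ι else 0 := by
  simp only [pauliString, Matrix.of_apply, ← Finset.prod_mul_distrib]
  rw [sum_prod_pi fun i p => pauli p (x i) (y i) * pauli p (z i) (w i)]
  simp only [sum_pauli_mul_pauli, Finset.prod_ite_zero, funext_iff, ← forall_and]
  simp

/-- The sum of `P ⊗ P` over all Pauli strings is `2^N` times the swap, evaluated here on `ψ ⊗ φ`. -/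
theorem sum_pauli_expectation_mul (ψ φ : Bits ι → ℂ) :
    ∑ v : ι → Fin 4, (star ψ ⬝ᵥ (pauliString v).mulVec ψ) * (star φ ⬝ᵥ (pauliString v).mulVec φ)
      = 2 ^ Fintype.card ι * ((star φ ⬝ᵥ ψ) * (star ψ ⬝ᵥ φ)) := by
  have h : ∀ v : ι → Fin 4,
      (star ψ ⬝ᵥ (pauliString v).mulVec ψ) * (star φ ⬝ᵥ (pauliString v).mulVec φ)
      = ∑ x, ∑ y, ∑ z, ∑ w, star (ψ x) * ψ y * star (φ z) * φ w
          * (pauliString v x y * pauliString v z w) := fun v => by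
    have he : ∀ χ : Bits ι → ℂ, star χ ⬝ᵥ (pauliString v).mulVec χ
        = ∑ x, ∑ y, star (χ x) * χ y * pauliString v x y := fun χ => by
      simp only [dotProduct, Matrix.mulVec, Finset.mul_sum, Pi.star_apply]
      exact Finset.sum_congr rfl fun x _ => Finset.sum_congr rfl fun y _ => by ring
    simp_rw [he, Finset.sum_mul, Finset.mul_sum]
    refine Finset.sum_congr rfl fun x _ => Finset.sum_congr rfl fun y _ =>
      Finset.sum_congr rfl fun z _ => Finset.sum_congr rfl fun w _ => ?_
    ring
  simp_rw [h]
  rw [Finset.sum_comm]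
  have h2 : ∀ x : Bits ι, ∑ v, ∑ y, ∑ z, ∑ w, star (ψ x) * ψ y * star (φ z) * φ w
          * (pauliString v x y * pauliString v z w)
      = ∑ y, star (ψ x) * ψ y * star (φ y) * φ x * 2 ^ Fintype.card ι := fun x => by
    rw [Finset.sum_comm]
    refine Finset.sum_congr rfl fun y _ => ?_
    rw [Finset.sum_comm]
    have : ∀ z, ∑ v, ∑ w, star (ψ x) * ψ y * star (φ z) * φ w
          * (pauliString v x y * pauliString v z w)
        = ∑ w, star (ψ x) * ψ y * star (φ z) * φ w
          * (if x = w ∧ y = z then 2 ^ Fintype.card ι else 0) := fun z => by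
      rw [Finset.sum_comm]
      simp_rw [← Finset.mul_sum, sum_pauliString_mul_pauliString]
    simp_rw [this]
    simp [ite_and]
  simp_rw [h2]
  simp only [dotProduct, Pi.star_apply]
  rw [mul_comm (∑ y, star (φ y) * ψ y), Finset.sum_mul_sum, Finset.mul_sum]
  simp_rw [Finset.mul_sum]
  refine Finset.sum_congr rfl fun x _ => Finset.sum_congr rfl fun y _ => ?_
  ring

theorem coe_overlap_of_isHermitian {a : Type*} [Fintype a] {A : Op a} (hA : A.IsHermitian)
    (ψ : a → ℂ) : ((overlap ψ A : ℝ) : ℂ) = star ψ ⬝ᵥ A.mulVec ψ := by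
  refine Complex.conj_eq_iff_re.1 ?_
  rw [starRingEnd_apply, ← Matrix.star_dotProduct, Matrix.star_mulVec, hA.eq,
    ← Matrix.dotProduct_mulVec]

theorem coe_overlap_ketBra {a : Type*} [Fintype a] (φ ψ : a → ℂ) :
    ((overlap φ (ketBra ψ) : ℝ) : ℂ) = (star φ ⬝ᵥ ψ) * (star ψ ⬝ᵥ φ) := by
  rw [coe_overlap_of_isHermitian (posSemidef_ketBra ψ).isHermitian, ketBra,
    Matrix.vecMulVec_mulVec, op_smul_eq_smul, dotProduct_smul, smul_eq_mul, mul_comm]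

theorem sum_overlap_pauliString_mul (ψ φ : Bits ι → ℂ) :
    ∑ v : ι → Fin 4, overlap ψ (pauliString v) * overlap φ (pauliString v)
      = 2 ^ Fintype.card ι * overlap φ (ketBra ψ) := by
  have h := sum_pauli_expectation_mul ψ φ
  have hv : ∀ (χ : Bits ι → ℂ) v, star χ ⬝ᵥ (pauliString v).mulVec χ
      = ((overlap χ (pauliString v) : ℝ) : ℂ) := fun χ v =>
    (coe_overlap_of_isHermitian (conjTranspose_pauliString v) χ).symm
  simp_rw [hv, ← coe_overlap_ketBra] at h
  exact_mod_cast h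

theorem overlap_sq_of_mem_stabilizerSet {ψ : Bits ι → ℂ} (hψ : star ψ ⬝ᵥ ψ = 1) {v : ι → Fin 4}
    (hv : v ∈ stabilizerSet ψ) : overlap ψ (pauliString v) ^ 2 = 1 := by
  obtain ⟨c, hc⟩ := hv
  have h := coe_overlap_of_isHermitian (conjTranspose_pauliString v) ψ
  rw [hc, dotProduct_smul, hψ, smul_eq_mul, mul_one] at h
  have h2 := pauliString_eigenvalue_sq (ne_zero_of_normalized hψ) hc
  rw [← h] at h2
  exact_mod_cast h2

/-- The Pauli expectation values of a stabilizer vector vanish outside its stabilizer. -/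
theorem overlap_eq_zero_of_notMem_stabilizerSet {ψ : Bits ι → ℂ} (hψ : IsStabilizerVector ψ)
    {v : ι → Fin 4} (hv : v ∉ stabilizerSet ψ) : overlap ψ (pauliString v) = 0 := by
  classical
  obtain ⟨h1, hcard⟩ := isStabilizerVector_iff.1 hψ
  -- Purity fixes the sum of all squared expectation values at `2^N`. The `2^N` stabilizing strings,
  -- each contributing `1`, already exhaust it.
  have htot : ∑ v : ι → Fin 4, overlap ψ (pauliString v) ^ 2 = 2 ^ Fintype.card ι := by
    simp_rw [sq (overlap ψ _), sum_overlap_pauliString_mul ψ ψ]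
    have : overlap ψ (ketBra ψ) = 1 := by
      have := coe_overlap_ketBra ψ ψ
      rw [h1, mul_one] at this
      exact_mod_cast this
    rw [this, mul_one]
  have hS : ∑ v with v ∈ stabilizerSet ψ, overlap ψ (pauliString v) ^ 2
      = 2 ^ Fintype.card ι := by
    rw [Finset.sum_congr rfl fun v hv =>
      overlap_sq_of_mem_stabilizerSet h1 (Finset.mem_filter.1 hv).2]
    rw [Set.ncard_eq_toFinset_card', Set.toFinset_card, Fintype.card_subtype] at hcard
    simp only [Finset.sum_const, nsmul_eq_mul, mul_one]
    exact_mod_cast hcard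
  rw [← Finset.sum_filter_add_sum_filter_not _ (· ∈ stabilizerSet ψ), hS, add_eq_left,
    Finset.sum_eq_zero_iff_of_nonneg fun _ _ => sq_nonneg _] at htot
  exact pow_eq_zero_iff two_ne_zero |>.1 (htot v (by simp [hv]))

omit [DecidableEq ι] in
theorem prod_pauliSign_eq_or (v w : ι → Fin 4) :
    ∏ i, pauliSign (v i) (w i) = 1 ∨ ∏ i, pauliSign (v i) (w i) = -1 := by
  refine Finset.prod_induction _ (fun z => z = 1 ∨ z = -1) ?_ (Or.inl rfl) fun i _ => ?_
  · rintro a b (rfl | rfl) (rfl | rfl) <;> simp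
  · unfold pauliSign
    split_ifs <;> simp

/-- Pauli strings with a common eigenvector commute. -/
theorem prod_pauliSign_eq_one {ψ : Bits ι → ℂ} (hψ : ψ ≠ 0) {v w : ι → Fin 4}
    (hv : v ∈ stabilizerSet ψ) (hw : w ∈ stabilizerSet ψ) :
    ∏ i, pauliSign (v i) (w i) = 1 := by
  refine (prod_pauliSign_eq_or v w).resolve_right fun h => ?_
  obtain ⟨c, hc⟩ := hv
  obtain ⟨d, hd⟩ := hw
  have hcomm := congrArg (fun A => A.mulVec ψ) (pauliString_mul_comm v w)
  simp only [h, ← Matrix.mulVec_mulVec, Matrix.smul_mulVec, hc, hd, Matrix.mulVec_smul,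
    smul_smul] at hcomm
  have h3 := smul_left_injective ℂ hψ hcomm
  have hc2 := pauliString_eigenvalue_sq hψ hc
  have hd2 := pauliString_eigenvalue_sq hψ hd
  have hcd : d * c = 0 := by
    push_cast at h3
    linear_combination h3 / 2
  have : (d * c) ^ 2 = 1 := by rw [mul_pow, hc2, hd2, one_mul]
  simp [hcd] at this

end Expectation

/-! ### Stabilizer fidelity of `|T⟩^{⊗ m}` -/

section Fidelity

/-- The Pauli expectation values of `|T⟩`. -/
noncomputable def pauliWeight : Fin 4 → ℝ := ![1, 1 / √2, 1 / √2, 0]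

theorem pauliWeight_nonneg (p : Fin 4) : 0 ≤ pauliWeight p := by
  fin_cases p <;> simp [pauliWeight]

theorem sum_cons_eq {m : ℕ} (S : Finset (Fin (m + 1) → Fin 4)) (g : Fin 4 → ℝ) :
    ∑ v ∈ S, ∏ i, g (v i)
      = ∑ p, g p * ∑ u : Fin m → Fin 4 with Fin.cons p u ∈ S, ∏ i, g (u i) := by
  classical
  have h : ∑ v ∈ S, ∏ i, g (v i) = ∑ v, if v ∈ S then ∏ i, g (v i) else 0 := by simp
  rw [h, ← (Fin.consEquiv fun _ => Fin 4).sum_comp, Fintype.sum_prod_type]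
  refine Finset.sum_congr rfl fun p _ => ?_
  rw [Finset.mul_sum, Finset.sum_filter]
  refine Finset.sum_congr rfl fun u _ => ?_
  simp [Fin.consEquiv, Fin.prod_univ_succ]

/-- A set of pairwise commuting Pauli strings has total weight at most `(1 + 1/√2)^m`. -/
theorem sum_prod_pauliWeight_le (m : ℕ) (S : Finset (Fin m → Fin 4))
    (hS : ∀ v ∈ S, ∀ w ∈ S, ∏ i, pauliSign (v i) (w i) = 1) :
    ∑ v ∈ S, ∏ i, pauliWeight (v i) ≤ (1 + 1 / √2) ^ m := by
  classical
  induction m with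
  | zero =>
    simp only [Finset.univ_eq_empty, Finset.prod_empty, Finset.sum_const, pow_zero, nsmul_eq_mul,
      mul_one]
    exact_mod_cast (Finset.card_le_univ S).trans (by simp)
  | succ m ih =>
    let T : Fin 4 → Finset (Fin m → Fin 4) := fun p => {u | Fin.cons p u ∈ S}
    let f : Finset (Fin m → Fin 4) → ℝ := fun A => ∑ u ∈ A, ∏ i, pauliWeight (u i)
    have hsign : ∀ p q, ∀ u ∈ T p, ∀ w ∈ T q,
        pauliSign p q * ∏ i, pauliSign (u i) (w i) = 1 := fun p q u hu w hw => by
      have := hS _ (Finset.mem_filter.1 hu).2 _ (Finset.mem_filter.1 hw).2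
      simpa [Fin.prod_univ_succ] using this
    have hf0 : ∀ A, 0 ≤ f A := fun A =>
      Finset.sum_nonneg fun u _ => Finset.prod_nonneg fun i _ => pauliWeight_nonneg _
    -- The letters `0` and `p` commute with each other and themselves, so the tails in `T 0 ∪ T p`
    -- commute pairwise and the induction hypothesis applies.
    have hunion : ∀ p, f (T 0 ∪ T p) ≤ (1 + 1 / √2) ^ m := fun p => by
      refine ih _ fun v hv w hw => ?_
      rcases Finset.mem_union.1 hv with hv | hv <;> rcases Finset.mem_union.1 hw with hw | hw <;>
        simpa [pauliSign] using hsign _ _ v hv w hw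
    have hle : ∀ p, f (T 0) ≤ (1 + 1 / √2) ^ m ∧ f (T p) ≤ (1 + 1 / √2) ^ m := fun p =>
      ⟨(Finset.sum_le_sum_of_subset_of_nonneg Finset.subset_union_left fun u _ _ =>
          Finset.prod_nonneg fun i _ => pauliWeight_nonneg _).trans (hunion p),
        (Finset.sum_le_sum_of_subset_of_nonneg Finset.subset_union_right fun u _ _ =>
          Finset.prod_nonneg fun i _ => pauliWeight_nonneg _).trans (hunion p)⟩
    have hsum : ∑ v ∈ S, ∏ i, pauliWeight (v i)
        = f (T 0) + 1 / √2 * (f (T 1) + f (T 2)) := by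
      rw [sum_cons_eq, Fin.sum_univ_four]
      simp only [pauliWeight, Matrix.cons_val, f, T]
      ring
    -- A common tail of `T 0` and `T p` would both commute and anticommute with any tail in `T q`.
    have hdisj : ∀ p q : Fin 4, pauliSign p q = -1 → (T q).Nonempty → Disjoint (T 0) (T p) := by
      rintro p q hpq ⟨w, hw⟩
      refine Finset.disjoint_left.2 fun u hu0 hup => ?_
      have h0 := hsign 0 q u hu0 w hw
      have hp := hsign p q u hup w hw
      rw [hpq] at hp
      rw [show pauliSign 0 q = 1 by simp [pauliSign], one_mul] at h0
      rw [h0] at hp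
      norm_num at hp
    have hs : 0 ≤ 1 / √2 := by positivity
    have hs1 : 1 / √2 ≤ 1 := by
      rw [div_le_one (by positivity)]
      exact Real.one_le_sqrt.2 (by norm_num)
    rw [hsum, pow_succ]
    have hc : 0 ≤ (1 + 1 / √2) ^ m := by positivity
    -- If `T 1` or `T 2` is empty, bounding the remaining two terms separately suffices. Otherwise
    -- disjointness gives `f (T 0) + f (T p) ≤ c` for `p = 1, 2`, with `c` the inductive bound.
    -- Writing `r = 1/√2`, the total is at most `2 r c + (1 - 2 r) f (T 0) ≤ 2 r c ≤ (1 + r) c`,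
    -- since `1/2 ≤ r ≤ 1`.
    rcases (T 1).eq_empty_or_nonempty with h1 | h1
    · have : f (T 1) = 0 := by simp [f, h1]
      nlinarith [hle 2, mul_le_mul_of_nonneg_left (hle 2).2 hs]
    rcases (T 2).eq_empty_or_nonempty with h2 | h2
    · have : f (T 2) = 0 := by simp [f, h2]
      nlinarith [hle 1, mul_le_mul_of_nonneg_left (hle 1).2 hs]
    have e1 : f (T 0) + f (T 1) ≤ (1 + 1 / √2) ^ m := by
      have := hunion 1
      simp only [f] at this ⊢
      rwa [Finset.sum_union (hdisj 1 2 (by decide) h2)] at this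
    have e2 : f (T 0) + f (T 2) ≤ (1 + 1 / √2) ^ m := by
      have := hunion 2
      simp only [f] at this ⊢
      rwa [Finset.sum_union (hdisj 2 1 (by decide) h1)] at this
    have hs2 : 1 ≤ 2 * (1 / √2) := by
      rw [mul_one_div, le_div_iff₀ (by positivity), one_mul]
      exact Real.sqrt_le_iff.2 (by norm_num)
    nlinarith [hf0 (T 0), mul_nonneg (sub_nonneg.2 hs2) (hf0 (T 0)),
      mul_le_mul_of_nonneg_left (add_le_add e1 e2) hs, mul_nonneg (sub_nonneg.2 hs1) hc]

theorem ketT_eq : ketT = ![((1 / √2 : ℝ) : ℂ), 1 / 2 + 1 / 2 * Complex.I] := by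
  have h2 : ((√2 : ℝ) : ℂ) ≠ 0 := by simp
  have he : Complex.exp (Complex.I * Real.pi / 4) = (√2 / 2 : ℝ) + (√2 / 2 : ℝ) * Complex.I := by
    rw [show Complex.I * Real.pi / 4 = ((Real.pi / 4 : ℝ) : ℂ) * Complex.I by push_cast; ring,
      Complex.exp_mul_I, ← Complex.ofReal_cos, ← Complex.ofReal_sin, Real.cos_pi_div_four,
      Real.sin_pi_div_four]
  rw [ketT, he]
  congr 2
  · push_cast
    rfl
  · push_cast
    field_simp

theorem ketT_normalized : star ketT ⬝ᵥ ketT = 1 := by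
  rw [ketT_eq]
  have h : √2 * √2 = 2 := Real.mul_self_sqrt (by norm_num)
  apply Complex.ext
  · simp [dotProduct, Fin.sum_univ_two]
    linarith
  · simp [dotProduct, Fin.sum_univ_two]

theorem overlap_ketT_pauli (p : Fin 4) : overlap ketT (pauli p) = pauliWeight p := by
  have h : √2 * √2 = 2 := Real.mul_self_sqrt (by norm_num)
  have hinv : (√2)⁻¹ = √2 / 2 := by
    field_simp
    linarith
  rw [ketT_eq]
  fin_cases p <;>
    simp [overlap, pauli, pauliWeight, dotProduct, Matrix.mulVec, Fin.sum_univ_two] <;> linarith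

/-- `|T⟩^{⊗ m}`. -/
noncomputable def ketTPow (m : ℕ) : Bits (Fin m) → ℂ := tensorVec fun _ => ketT

theorem ketTPow_normalized (m : ℕ) : star (ketTPow m) ⬝ᵥ ketTPow m = 1 := by
  rw [ketTPow, star_tensorVec, tensorVec_dotProduct]
  simp only [ketT_normalized, Finset.prod_const_one]

theorem overlap_ketTPow_pauliString {m : ℕ} (v : Fin m → Fin 4) :
    overlap (ketTPow m) (pauliString v) = ∏ i, pauliWeight (v i) := by
  have h := coe_overlap_of_isHermitian (conjTranspose_pauliString v) (ketTPow m)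
  rw [pauliString_eq_tensorMatrix, ketTPow, tensorMatrix_mulVec, star_tensorVec,
    tensorVec_dotProduct] at h
  simp_rw [← coe_overlap_of_isHermitian (conjTranspose_pauli _) ketT, overlap_ketT_pauli] at h
  rw [pauliString_eq_tensorMatrix, ketTPow]
  exact_mod_cast h

/-- Only stabilizing strings contribute to the Pauli expansion of the overlap. Their expectation
values in `ψ` are signs, and they commute, so the weight bound applies. -/
theorem overlap_ketTPow_ketBra_le {m : ℕ} {ψ : Bits (Fin m) → ℂ} (hψ : IsStabilizerVector ψ) :
    overlap (ketTPow m) (ketBra ψ) ≤ ((1 + 1 / √2) / 2) ^ m := by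
  classical
  have h := sum_overlap_pauliString_mul ψ (ketTPow m)
  rw [← Finset.sum_filter_of_ne (p := (· ∈ stabilizerSet ψ)) fun v _ hv => by
    by_contra hn
    simp [overlap_eq_zero_of_notMem_stabilizerSet hψ hn] at hv] at h
  have hle : ∑ v with v ∈ stabilizerSet ψ,
        overlap ψ (pauliString v) * overlap (ketTPow m) (pauliString v)
      ≤ ∑ v with v ∈ stabilizerSet ψ, ∏ i, pauliWeight (v i) := by
    refine Finset.sum_le_sum fun v hv => ?_
    rw [overlap_ketTPow_pauliString]
    refine mul_le_of_le_one_left (Finset.prod_nonneg fun i _ => pauliWeight_nonneg _) ?_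
    have := overlap_sq_of_mem_stabilizerSet hψ.1 (Finset.mem_filter.1 hv).2
    nlinarith [sq_nonneg (overlap ψ (pauliString v) - 1)]
  have hb := sum_prod_pauliWeight_le m {v | v ∈ stabilizerSet ψ} fun v hv w hw =>
    prod_pauliSign_eq_one (ne_zero_of_normalized hψ.1) (Finset.mem_filter.1 hv).2
      (Finset.mem_filter.1 hw).2
  rw [div_pow, le_div_iff₀ (by positivity), mul_comm]
  rw [h, Fintype.card_fin] at hle
  exact hle.trans hb

theorem overlap_ketTPow_le_of_mem_freeStates {m : ℕ} {σ : Op (Bits (Fin m))}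
    (hσ : σ ∈ freeStates (Fin m)) :
    overlap (ketTPow m) σ ≤ ((1 + 1 / √2) / 2) ^ m := by
  refine convexHull_min (t := {σ | overlap (ketTPow m) σ ≤ ((1 + 1 / √2) / 2) ^ m}) ?_ ?_ hσ
  · rintro _ ⟨ψ, hψ, rfl⟩
    exact overlap_ketTPow_ketBra_le hψ
  · refine convex_halfSpace_le (IsLinearMap.mk ?_ ?_) _
    · intro A B
      simp [overlap, Matrix.add_mulVec]
    · intro r A
      exact overlap_smul _ r A

end Fidelity

/-! ### Reduced states -/

section Marginal

variable {κ : Type*} [Fintype κ] [DecidableEq κ]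

theorem tensorMatrix_update_one (A : Op (Fin 2)) (i : κ) (y x : Bits κ) :
    tensorMatrix (Function.update (fun _ : κ => (1 : Op (Fin 2))) i A) y x
      = ∑ b, if y = Function.update x i b then A b (x i) else 0 := by
  have h1 : tensorMatrix (Function.update (fun _ : κ => (1 : Op (Fin 2))) i A) y x
      = A (y i) (x i) * ∏ j ∈ Finset.univ.erase i, (1 : Op (Fin 2)) (y j) (x j) := by
    rw [tensorMatrix, Matrix.of_apply, ← Finset.mul_prod_erase _ _ (Finset.mem_univ i),
      Function.update_self]
    congr 1
    refine Finset.prod_congr rfl fun j hj => ?_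
    rw [Function.update_of_ne (Finset.ne_of_mem_erase hj)]
  rw [h1, Finset.sum_eq_single (y i)]
  · simp only [Matrix.one_apply, Finset.prod_ite_zero, Finset.prod_const_one, mul_ite, mul_one,
      mul_zero]
    refine if_congr ⟨fun h => ?_, fun h j hj => ?_⟩ rfl rfl
    · refine funext fun j => ?_
      by_cases hj : j = i
      · subst hj
        simp
      · rw [Function.update_of_ne hj]
        exact h j (by simp [hj])
    · rw [h, Function.update_of_ne (Finset.ne_of_mem_erase hj)]
  · intro b _ hb
    refine if_neg fun h => hb ?_
    rw [h, Function.update_self]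
  · simp

/-- The defining duality of the partial trace: it lets one-qubit measurements on marginals be read
as measurements on `τ`. -/
theorem trace_mul_tensorMatrix_update (τ : Op (Bits κ)) (A : Op (Fin 2)) (i : κ) :
    (τ * tensorMatrix (Function.update (fun _ : κ => (1 : Op (Fin 2))) i A)).trace
      = (marginal τ i * A).trace := by
  have hl : (τ * tensorMatrix (Function.update (fun _ : κ => (1 : Op (Fin 2))) i A)).trace
      = ∑ x, ∑ b, τ x (Function.update x i b) * A b (x i) := by
    simp only [Matrix.trace, Matrix.diag_apply, Matrix.mul_apply, tensorMatrix_update_one,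
      Finset.mul_sum]
    refine Finset.sum_congr rfl fun x _ => ?_
    rw [Finset.sum_comm]
    simp
  have hr : (marginal τ i * A).trace
      = ∑ a, ∑ x : Bits κ with x i = a, ∑ b, τ x (Function.update x i b) * A b (x i) := by
    simp only [Matrix.trace, Matrix.diag_apply, Matrix.mul_apply, marginal, Matrix.of_apply,
      Finset.sum_mul]
    refine Finset.sum_congr rfl fun a _ => ?_
    rw [Finset.sum_comm]
    refine Finset.sum_congr rfl fun x hx => ?_
    rw [(Finset.mem_filter.1 hx).2]
  rw [hl, hr, Finset.sum_fiberwise]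

theorem re_trace_mul_one_sub_ketBra {a : Type*} [Fintype a] [DecidableEq a] (ψ : a → ℂ)
    (X : Op a) : (X * (1 - ketBra ψ)).trace.re = infidelity ψ X := by
  rw [mul_sub, mul_one, Matrix.trace_sub, trace_mul_ketBra, Complex.sub_re]
  rfl

theorem trace_marginal (τ : Op (Bits κ)) (i : κ) : (marginal τ i).trace = τ.trace := by
  have h := trace_mul_tensorMatrix_update τ 1 i
  rw [Function.update_eq_self i fun _ : κ => (1 : Op (Fin 2)), tensorMatrix_one, mul_one,
    mul_one] at h
  exact h.symm

/-- The infidelity with a product vector is at most the sum of the infidelities of the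
marginals. -/
theorem infidelity_tensorVec_le_sum_marginal {χ : Fin 2 → ℂ} (hχ : star χ ⬝ᵥ χ = 1)
    {τ : Op (Bits κ)} (hτ : τ.PosSemidef) :
    infidelity (tensorVec fun _ : κ => χ) τ ≤ ∑ i, infidelity χ (marginal τ i) := by
  let Q : Bool → Op (Fin 2) := fun b => bif b then ketBra χ else 1 - ketBra χ
  have hQ : ∀ b, (Q b).PosSemidef := by
    rintro (_ | _)
    · exact posSemidef_one_sub_ketBra hχ
    · exact posSemidef_ketBra χ
  have hQsum : ∑ b, Q b = 1 := by simp [Q]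
  -- Joint outcome weights when every qubit is tested for `χ`; `true` means that the test passes.
  let q : (κ → Bool) → ℝ := fun f => (τ * tensorMatrix fun i => Q (f i)).trace.re
  have hq : ∀ f, 0 ≤ q f := fun f => (Complex.le_def.1 (PosSemidef.trace_mul_nonneg hτ
    (posSemidef_tensorMatrix fun i => hQ (f i)))).1
  have htot : τ.trace.re = ∑ f, q f := by
    have h := tensorMatrix_sum fun (_ : κ) b => Q b
    simp only [hQsum, tensorMatrix_one] at h
    simp only [q]
    rw [← Complex.re_sum, ← Matrix.trace_sum, ← Matrix.mul_sum, ← h, mul_one]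
  have htrue : overlap (tensorVec fun _ : κ => χ) τ = q fun _ => true := by
    simp only [q, Q, cond_true]
    rw [← ketBra_tensorVec, trace_mul_ketBra]
    rfl
  have hmarg : ∀ i, infidelity χ (marginal τ i) = ∑ f : κ → Bool, if f i then 0 else q f :=
      fun i => by
    rw [← re_trace_mul_one_sub_ketBra, ← trace_mul_tensorMatrix_update]
    -- Resolve the identity on every qubit other than `i`, and keep only the failing outcome on
    -- qubit `i`.
    have hu : Function.update (fun _ : κ => (1 : Op (Fin 2))) i (1 - ketBra χ)
        = fun j => ∑ b, if j = i ∧ b = true then 0 else Q b := by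
      ext1 j
      by_cases hj : j = i
      · subst hj
        simp [Q]
      · simp [hj, ← hQsum]
    rw [hu, tensorMatrix_sum, Matrix.mul_sum, Matrix.trace_sum, Complex.re_sum]
    refine Finset.sum_congr rfl fun f _ => ?_
    split_ifs with hf
    · have : tensorMatrix (fun j => if j = i ∧ f j = true then 0 else Q (f j)) = 0 := by
        ext x y
        exact Finset.prod_eq_zero (Finset.mem_univ i) (by simp [hf])
      rw [this, mul_zero, Matrix.trace_zero, Complex.zero_re]
    · have : (fun j => if j = i ∧ f j = true then 0 else Q (f j)) = fun j => Q (f j) := by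
        ext1 j
        refine if_neg ?_
        rintro ⟨rfl, h⟩
        exact hf h
      rw [this]
  have h1 : ∑ f, q f - (q fun _ => true) = ∑ f, if f = fun _ => true then 0 else q f := by
    rw [← Finset.add_sum_erase _ q (Finset.mem_univ fun _ => true), add_sub_cancel_left,
      ← Finset.add_sum_erase _ (fun f => if f = fun _ => true then 0 else q f)
        (Finset.mem_univ fun _ => true), if_pos rfl, zero_add]
    exact Finset.sum_congr rfl fun f hf => (if_neg (Finset.ne_of_mem_erase hf)).symm
  rw [infidelity, htot, htrue, h1]
  simp_rw [hmarg]
  rw [Finset.sum_comm]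
  -- Union bound: an outcome other than all-pass fails at some qubit, so its weight is counted at
  -- least once on the right.
  refine Finset.sum_le_sum fun f _ => ?_
  have hnn : ∀ i ∈ Finset.univ, 0 ≤ if f i then 0 else q f := fun i _ => by
    split_ifs
    exacts [le_rfl, hq f]
  split_ifs with hf
  · exact Finset.sum_nonneg hnn
  · obtain ⟨i, hi⟩ := Function.ne_iff.1 hf
    have := Finset.single_le_sum hnn (Finset.mem_univ i)
    simpa [hi] using this

end Marginal

/-! ### Tensor powers of operator inequalities -/

section Copies

variable {ι : Type*} [Fintype ι] [DecidableEq ι]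

omit [Fintype ι] [DecidableEq ι] in
theorem copies_smul (n : ℕ) (r : ℝ) (ρ : Op (Bits ι)) : copies n (r • ρ) = r ^ n • copies n ρ := by
  ext x y
  simp [copies, Finset.prod_mul_distrib]

theorem trace_copies (n : ℕ) (ρ : Op (Bits ι)) : (copies n ρ).trace = ρ.trace ^ n := by
  rw [copies_eq_submatrix]
  have : ((tensorMatrix fun _ : Fin n => ρ).submatrix Function.curry Function.curry).trace
      = (tensorMatrix fun _ : Fin n => ρ).trace :=
    (Equiv.curry (Fin n) ι (Fin 2)).sum_comp fun x => tensorMatrix (fun _ : Fin n => ρ) x x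
  rw [this, trace_tensorMatrix]
  simp

omit [DecidableEq ι] in
theorem posSemidef_copies_sub (n : ℕ) {ρ ω : Op (Bits ι)} {r : ℝ} (hr : 0 ≤ r)
    (hω : ω.PosSemidef) (h : (ρ - r • ω).PosSemidef) :
    (copies n ρ - r ^ n • copies n ω).PosSemidef := by
  rw [← copies_smul]
  exact (posSemidef_tensorMatrix_sub (J := Fin n) (hω.smul hr) h).submatrix Function.curry

/-! ### Robustness -/

/-- The robustness is an infimum over a nonempty set. -/
theorem robustness_set_nonempty [Nonempty ι] {ρ : Op (Bits ι)} (hρ : IsState ρ) :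
    {s : ℝ | 0 ≤ s ∧ ∃ σ : Op (Bits ι), IsState σ ∧
      (1 + s)⁻¹ • (ρ + s • σ) ∈ freeStates ι}.Nonempty := by
  have hd : (1 : ℝ) < 2 ^ Fintype.card ι := one_lt_pow₀ (by norm_num) Fintype.card_ne_zero
  have hd' : (2 : ℝ) ^ Fintype.card ι - 1 ≠ 0 := by linarith
  -- With `d = 2^N`, mixing in `(1 - ρ) / (d - 1)` with `s = d - 1` gives the maximally mixed state
  -- `1 / d`.
  refine ⟨2 ^ Fintype.card ι - 1, by linarith,
    ((2 : ℝ) ^ Fintype.card ι - 1)⁻¹ • (1 - ρ), ⟨?_, ?_⟩, ?_⟩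
  · have := posSemidef_trace_smul_one_sub hρ.1
    rw [hρ.2, Complex.one_re, one_smul] at this
    exact this.smul (inv_nonneg.2 (by linarith))
  · have : ((2 : ℂ) ^ Fintype.card ι - 1) ≠ 0 := by exact_mod_cast hd'
    simp [hρ.2, this]
  · rw [smul_smul, mul_inv_cancel₀ hd', one_smul, add_sub_cancel, add_sub_cancel]
    exact maximallyMixed_mem_freeStates

/-- A closed condition that holds for all admissible mixing weights holds for the robustness. -/
theorem robustness_mem_of_isClosed [Nonempty ι] {ρ : Op (Bits ι)} (hρ : IsState ρ) {S : Set ℝ}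
    (hS : IsClosed S) (h : ∀ s, 0 ≤ s → ∀ σ, IsState σ →
      (1 + s)⁻¹ • (ρ + s • σ) ∈ freeStates ι → s ∈ S) : robustness ρ ∈ S :=
  closure_minimal (fun s hs => h s hs.1 hs.2.choose hs.2.choose_spec.1 hs.2.choose_spec.2) hS
    (csInf_mem_closure (robustness_set_nonempty hρ) ⟨0, fun _ hs => hs.1⟩)

end Copies

/-! ### The bound -/

/-- The infidelity achieved by a free sub-operation, compared with that of free states. -/
theorem infidelity_bound {ι κ : Type*} [Fintype ι] [DecidableEq ι] [Fintype κ] [DecidableEq κ]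
    {n : ℕ} {L : Op (Bits (Fin n × ι)) →ₗ[ℂ] Op (Bits κ)} (hL : IsFreeSubOperation L)
    {ρ : Op (Bits ι)} (hρ : IsState ρ) (hmin : 0 ≤ minEigenvalue ρ)
    {p : ℝ} (hp : 0 < p) {τ : Op (Bits κ)} (hτ : IsState τ) (hLρ : L (copies n ρ) = p • τ)
    {ψ : Bits κ → ℂ} (hψ : star ψ ⬝ᵥ ψ = 1) {f : ℝ} (hf1 : f ≤ 1)
    (hf : ∀ σ ∈ freeStates κ, overlap ψ σ ≤ f)
    {s : ℝ} (hs : 0 ≤ s) {σ : Op (Bits ι)} (hσ : IsState σ)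
    (hω : (1 + s)⁻¹ • (ρ + s • σ) ∈ freeStates ι) :
    minEigenvalue ρ ^ n * (1 - f) ≤ (1 + s) ^ n * infidelity ψ τ := by
  set ω := (1 + s)⁻¹ • (ρ + s • σ) with hωdef
  have hs1 : 0 < 1 + s := by linarith
  obtain ⟨⟨hω0, -⟩, hω1⟩ := isState_of_mem_freeStates hω
  have hle1 : (ρ - minEigenvalue ρ • ω).PosSemidef := by
    have : ρ - minEigenvalue ρ • ω
        = (ρ - minEigenvalue ρ • (1 : Op (Bits ι))) + minEigenvalue ρ • (1 - ω) := by
      rw [smul_sub]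
      abel
    rw [this]
    exact (posSemidef_sub_minEigenvalue hρ.1.1).add (hω1.smul hmin)
  have hle2 : (ω - (1 + s)⁻¹ • ρ).PosSemidef := by
    rw [hωdef, smul_add, add_sub_cancel_left]
    exact (hσ.1.smul hs).smul (inv_nonneg.2 hs1.le)
  obtain ⟨t, ht, σ', hσ', hLω⟩ := hL.2 _ (copies_mem_freeStates n hω)
  obtain ⟨⟨hσ0, hσt⟩, -⟩ := isState_of_mem_freeStates hσ'
  have hm1 := hL.1.1.posSemidef (posSemidef_copies_sub n hmin hω0 hle1)
  have hm2 := hL.1.1.posSemidef (posSemidef_copies_sub n (inv_nonneg.2 hs1.le) hρ.1 hle2)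
  rw [map_sub, LinearMap.map_smul_of_tower, hLρ, hLω] at hm1 hm2
  -- Trace of `t σ' ≥ (1 + s)^{-n} p τ`.
  have ht' : p ≤ (1 + s) ^ n * t := by
    have := (Complex.le_def.1 hm2.trace_nonneg).1
    simp only [Matrix.trace_sub, Matrix.trace_smul, hτ.2, hσt, Complex.sub_re, Complex.smul_re,
      Complex.zero_re, Complex.one_re, smul_eq_mul, mul_one, inv_pow, sub_nonneg] at this
    rwa [inv_mul_le_iff₀ (by positivity)] at this
  -- Weight of `p τ ≥ λ^n t σ'` outside `ψ`.
  have hinf := infidelity_nonneg hψ hm1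
  rw [infidelity_sub, infidelity_smul, infidelity_smul, infidelity_smul, sub_nonneg] at hinf
  have hσf : 1 - f ≤ infidelity ψ σ' := by
    rw [infidelity, hσt, Complex.one_re]
    linarith [hf σ' hσ']
  have hmn : 0 ≤ minEigenvalue ρ ^ n := pow_nonneg hmin n
  refine le_of_mul_le_mul_left ?_ hp
  calc p * (minEigenvalue ρ ^ n * (1 - f))
      ≤ ((1 + s) ^ n * t) * (minEigenvalue ρ ^ n * (1 - f)) :=
        mul_le_mul_of_nonneg_right ht' (mul_nonneg hmn (sub_nonneg.2 hf1))
    _ = (1 + s) ^ n * (minEigenvalue ρ ^ n * (t * (1 - f))) := by ring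
    _ ≤ (1 + s) ^ n * (p * infidelity ψ τ) := by
        refine mul_le_mul_of_nonneg_left (le_trans ?_ hinf) (by positivity)
        exact mul_le_mul_of_nonneg_left (mul_le_mul_of_nonneg_left hσf ht) hmn
    _ = p * ((1 + s) ^ n * infidelity ψ τ) := by ring

end MagicDistillation

theorem theorem3 (k n m : ℕ) (hk : 0 < k) (hm : 0 < m)
    (ρ : Op (Bits (Fin k))) (hρ : IsState ρ) (hrank : ρ.rank = 2 ^ k)
    (E : Op (Bits (Fin n × Fin k)) →ₗ[ℂ] Op (Fin 2 × Bits (Fin m)))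
    (L : Op (Bits (Fin n × Fin k)) →ₗ[ℂ] Op (Bits (Fin m)))
    (hE : IsFreeProtocol E L)
    (p : ℝ) (hp : 0 < p) (τ : Op (Bits (Fin m))) (hτ : IsState τ)
    (hL : L (copies n ρ) = p • τ)
    (ε : ℝ) (hε : 0 < ε) (hT : ∀ i : Fin m, 1 - ε ≤ overlap ketT (marginal τ i)) :
    (n : ℝ) / m ≥ (1 / m) * Real.logb ((1 + robustness ρ) / minEigenvalue ρ)
      (((4 - 2 * √2) ^ m - 1) * p / ((4 - 2 * √2) ^ m * m * ε)) := by
  have : Nonempty (Fin k) := ⟨⟨0, hk⟩⟩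
  have hfree := hE.2.1
  have hmin : 0 < minEigenvalue ρ := minEigenvalue_pos hρ.1 (by simpa using hrank)
  have hmin1 : minEigenvalue ρ < 1 := by
    have h := card_mul_minEigenvalue_le hρ.1.1
    rw [hρ.2, Complex.one_re] at h
    have hd : (1 : ℝ) < 2 ^ k := one_lt_pow₀ (by norm_num) hk.ne'
    simp only [Fintype.card_pi, Fintype.card_fin, Finset.prod_const, Finset.card_univ] at h
    push_cast at h
    nlinarith
  have hp1 : p ≤ 1 := by
    have h := hfree.1.2 (copies n ρ)
      ((posSemidef_tensorMatrix fun _ : Fin n => hρ.1).submatrix Function.curry)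
    simpa [hL, trace_copies, hρ.2, hτ.2] using h
  have hR : 0 ≤ robustness ρ := Real.sInf_nonneg fun s hs => hs.1
  have hinf : infidelity (ketTPow m) τ ≤ m * ε := by
    refine (infidelity_tensorVec_le_sum_marginal ketT_normalized hτ.1).trans ?_
    calc ∑ i, infidelity ketT (marginal τ i) ≤ ∑ _i : Fin m, ε := by
          refine Finset.sum_le_sum fun i _ => ?_
          rw [infidelity, trace_marginal, hτ.2, Complex.one_re]
          linarith [hT i]
      _ = m * ε := by simp
  have h2 : √2 * √2 = 2 := Real.mul_self_sqrt (by norm_num)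
  have hsq : √2 < 3 / 2 := by
    rw [Real.sqrt_lt' (by norm_num)]
    norm_num
  set a : ℝ := 4 - 2 * √2 with ha
  have ha1 : 1 < a := by linarith
  -- Rationalisation: `(2 + √2)(4 - 2√2) = 4`.
  have hfa : (1 + 1 / √2) / 2 = a⁻¹ := by
    refine eq_inv_of_mul_eq_one_left ?_
    rw [ha]
    field_simp
    linarith
  have ham : 1 < a ^ m := one_lt_pow₀ ha1 hm.ne'
  have hm0 : (0 : ℝ) < m := by exact_mod_cast hm
  have hbound : minEigenvalue ρ ^ n * (1 - (a ^ m)⁻¹) ≤ (1 + robustness ρ) ^ n * (m * ε) := by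
    -- The infimum need not be known to be attained: the inequality is closed in `s`, so it passes
    -- to the limit.
    refine robustness_mem_of_isClosed hρ (S := {s : ℝ | minEigenvalue ρ ^ n * (1 - (a ^ m)⁻¹)
      ≤ (1 + s) ^ n * (m * ε)}) (isClosed_le (by fun_prop) (by fun_prop)) fun s hs σ hσ hω => ?_
    refine (infidelity_bound hfree hρ hmin.le hp hτ hL (ketTPow_normalized m)
      (inv_le_one_of_one_le₀ ham.le) (fun σ hσ => ?_) hs hσ hω).trans
      (mul_le_mul_of_nonneg_left hinf (by positivity))
    rw [← inv_pow, ← hfa]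
    exact overlap_ketTPow_le_of_mem_freeStates hσ
  have hb : 1 < (1 + robustness ρ) / minEigenvalue ρ := by
    rw [one_lt_div hmin]
    linarith
  have harg : 0 < (a ^ m - 1) * p / (a ^ m * m * ε) := by
    have := sub_pos.2 ham
    positivity
  have hlog : Real.logb ((1 + robustness ρ) / minEigenvalue ρ)
      ((a ^ m - 1) * p / (a ^ m * m * ε)) ≤ n := by
    rw [Real.logb_le_iff_le_rpow hb harg, Real.rpow_natCast, div_pow,
      div_le_div_iff₀ (by positivity) (by positivity)]
    -- The bound `hbound` is free of `p`; the factor in the statement only weakens it, because `p ≤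
    -- 1`.
    have h1 : (a ^ m - 1) * p ≤ a ^ m - 1 := mul_le_of_le_one_right (by linarith) hp1
    calc (a ^ m - 1) * p * minEigenvalue ρ ^ n
        ≤ (a ^ m - 1) * minEigenvalue ρ ^ n := mul_le_mul_of_nonneg_right h1 (by positivity)
      _ = a ^ m * (minEigenvalue ρ ^ n * (1 - (a ^ m)⁻¹)) := by field_simp
      _ ≤ a ^ m * ((1 + robustness ρ) ^ n * (m * ε)) :=
          mul_le_mul_of_nonneg_left hbound (by positivity)
      _ = (1 + robustness ρ) ^ n * (a ^ m * m * ε) := by ring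
  rw [ge_iff_le, one_div_mul_eq_div]
  exact div_le_div_of_nonneg_right hlog hm0.le
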